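/- Let $\mathcal A,\mathcal B$ be finite alphabets and let $\mathbf X=(X_n)_{n\in\mathbb Z}$, $\mathbf Y=(Y_n)_{n\in\mathbb Z}$ be jointly stationary (not necessarily ergodic) processes with values in $\mathcal A$ and $\mathcal B$. Write $z_a^b=(z_a,\dots,z_b)$. For $L\ge 1$ put $k=\lceil L\log_2|\mathcal A|\rceil$, and let $h_k$ be the binary prefix code for $\{1,\dots,2^k\}$ in which a header of $\lceil\log_2(1+k)\rceil$ bits describes $\lfloor\log_2 n\rfloor$ and, if $n<2^k$, is followed by the $\lfloor\log_2 n\rfloor$ binary digits of $n$ below the leading one; thus $\ell(h_k(n))=\lceil\log_2(1+k)\rceil+\lfloor\log_2 n\rfloor$ for $1\le n<2^k$ and $\ell(h_k(2^k))=\lceil\log_2(1+k)\rceil$, where $\ell$ denotes length in bits. The code $w_1(x_1^{NL}\,|\,y_1^{NL})$ for $N$ phrases of length $L$ with side information $y_1^{NL}$ is the following concatenation. First, $x_1^L$ is sent uncompressed with $k$ bits. Then, for $i=2,\dots,N$, let $$s_i=\min\{t:\ 0<t<(i-1)L+1,\ x_{(i-1)L+1}^{iL}=x_{(i-1)L+1-t}^{iL-t},\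 y_{(i-1)L+1}^{iL}=y_{(i-1)L+1-t}^{iL-t}\},$$ $$n_i=\bigl|\{t\in\{1,\dots,s_i\}:\ y_{(i-1)L+1}^{iL}=y_{(i-1)L+1-t}^{iL-t}\}\bigr|,$$ with $n_i=0$ if the set defining $s_i$ is empty. If $1\le n_i\le 2^k-1$, then $h_k(n_i)$ is sent; otherwise $h_k(2^k)$ is sent, followed by the phrase $x_{(i-1)L+1}^{iL}$ uncompressed with $k$ bits. Let $H(\mathbf X|\mathbf Y)=\lim_{n\to\infty}\frac1n H(X_1^n|Y_1^n)$ be the conditional entropy rate, in bits. Then this limit and both of the following limits exist, and $$\lim_{L\to\infty}\lim_{N\to\infty}\frac{\mathbb E\bigl[\ell\bigl(w_1(X_1^{NL}\,|\,Y_1^{NL})\bigr)\bigr]}{NL}\ \le\ H(\mathbf X|\mathbf Y).$$ -/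

import Mathlib

open MeasureTheory ProbabilityTheory Filter Topology

noncomputable section

namespace SideInfoLZ

/-! ## Jointly stationary processes and the conditional entropy rate -/

/-- The doubly infinite processes `X` and `Y` are jointly stationary: the law of the pair process
`(X, Y)` on `ℤ → A × B` is invariant under all time shifts. No ergodicity is required. -/
def JointlyStationary {Ω A B : Type*} [MeasurableSpace Ω] [MeasurableSpace A] [MeasurableSpace B]
    (μ : Measure Ω) (X : ℤ → Ω → A) (Y : ℤ → Ω → B) : Prop :=
  ∀ m : ℤ, μ.map (fun ω (n : ℤ) => (X (n + m) ω, Y (n + m) ω)) =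
    μ.map (fun ω (n : ℤ) => (X n ω, Y n ω))

/-- The block `(z_a, z_{a+1}, …, z_{a+L-1})` of a doubly infinite sequence `z`. -/
def block {S : Type*} (L : ℕ) (z : ℤ → S) (a : ℤ) : Fin L → S :=
  fun j => z (a + (j : ℕ))

/-- Conditional Shannon entropy, in bits, of finitely valued random variables:
`H(U | V) = ∑_{u,v} P(U = u, V = v) log₂ (1 / P(U = u | V = v))`
(terms with `P(U = u, V = v) = 0` vanish). -/
def condEntropy {Ω U V : Type*} [MeasurableSpace Ω] [Fintype U] [Fintype V]
    (μ : Measure Ω) (F : Ω → U) (G : Ω → V) : ℝ :=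
  ∑ u : U, ∑ v : V, μ.real {ω | F ω = u ∧ G ω = v} *
    Real.logb 2 (μ.real {ω | G ω = v} / μ.real {ω | F ω = u ∧ G ω = v})

/-- `H(X_1^n | Y_1^n) / n`, in bits per symbol. -/
def condEntropyPerSymbol {Ω A B : Type*} [MeasurableSpace Ω] [Fintype A] [Fintype B]
    (μ : Measure Ω) (X : ℤ → Ω → A) (Y : ℤ → Ω → B) (n : ℕ) : ℝ :=
  condEntropy μ (fun ω => block n (fun j => X j ω) 1) (fun ω => block n (fun j => Y j ω) 1) / n

/-- The conditional entropy rate `H(X | Y) = lim_{n → ∞} H(X_1^n | Y_1^n) / n`. -/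
def condEntropyRate {Ω A B : Type*} [MeasurableSpace Ω] [Fintype A] [Fintype B]
    (μ : Measure Ω) (X : ℤ → Ω → A) (Y : ℤ → Ω → B) : ℝ :=
  limUnder atTop (condEntropyPerSymbol μ X Y)

/-! ## Binary words -/

/-- The `w` lowest binary digits of `m`, as a word of `w` bits. -/
def bits (w m : ℕ) : List Bool :=
  (List.range w).map fun j => m.testBit j

/-- The universal prefix code `h_k` for the integers `1, …, 2^k`. A header of `⌈log₂ (1 + k)⌉` bits
carries `⌊log₂ n⌋ ∈ {0, …, k}`; if `n < 2^k` it is followed by the `⌊log₂ n⌋` binary digits of `n`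
below the leading one. (`Nat.clog 2` is `⌈log₂ ·⌉` and `Nat.log 2` is `⌊log₂ ·⌋`.) -/
def intCode (k n : ℕ) : List Bool :=
  if n < 2 ^ k then bits (Nat.clog 2 (1 + k)) (Nat.log 2 n) ++ bits (Nat.log 2 n) n
  else bits (Nat.clog 2 (1 + k)) k

theorem length_bits (w m : ℕ) : (bits w m).length = w := by
  simp [bits]

/-- The codeword lengths of `h_k`. -/
theorem length_intCode (k n : ℕ) : (intCode k n).length =
    if n < 2 ^ k then Nat.clog 2 (1 + k) + Nat.log 2 n else Nat.clog 2 (1 + k) := by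
  unfold intCode
  split_ifs <;> simp [length_bits]

/-- `k = ⌈L log₂ |A|⌉`, the number of bits that represent `L` symbols of the alphabet `A`. -/
def rawBits (A : Type*) [Fintype A] (L : ℕ) : ℕ :=
  ⌈(L : ℝ) * Real.logb 2 (Fintype.card A)⌉₊

/-- The uncompressed description of a phrase: its index in a fixed enumeration of `A^L`, written
with `k = ⌈L log₂ |A|⌉` bits. -/
def rawCode {A : Type*} [Fintype A] {L : ℕ} (u : Fin L → A) : List Bool :=
  bits (rawBits A L) (Fintype.equivFin (Fin L → A) u : ℕ)

/-! ## The fixed-length-parsing code with side information -/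

/-- The first position `(i - 1) L + 1` of the `i`-th phrase of length `L` (`i ≥ 1`). -/
def phraseStart (L i : ℕ) : ℤ := ((i : ℤ) - 1) * L + 1

/-- `IsMatch L z i t`: the `i`-th phrase of `z` equals the block of `z` that lies `t` positions
earlier, `z_{(i-1)L+1}^{iL} = z_{(i-1)L+1-t}^{iL-t}`. -/
def IsMatch {S : Type*} (L : ℕ) (z : ℤ → S) (i t : ℕ) : Prop :=
  block L z (phraseStart L i) = block L z (phraseStart L i - t)

/-- `s_i`: the least offset `t`, `0 < t < (i - 1) L + 1`, of a simultaneous match of the `i`-th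
phrases of `x` and `y`; it is `0` if there is none (the infimum of `∅ ⊆ ℕ` is `0`). -/
def matchOffset {A B : Type*} (L : ℕ) (x : ℤ → A) (y : ℤ → B) (i : ℕ) : ℕ :=
  sInf {t : ℕ | 0 < t ∧ t < (i - 1) * L + 1 ∧ IsMatch L (fun j => (x j, y j)) i t}

open Classical in
/-- `n_i`: the number of `y`-matches of the `i`-th phrase with offset in `[1 : s_i]`, and `0` if
there is no simultaneous match. -/
def matchCount {A B : Type*} (L : ℕ) (x : ℤ → A) (y : ℤ → B) (i : ℕ) : ℕ :=
  if 0 < matchOffset L x y i then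
    ((Finset.Icc 1 (matchOffset L x y i)).filter fun t => IsMatch L y i t).card
  else 0

/-- The codeword of the `i`-th phrase, `i ≥ 2`: `h_k(n_i)` if `n_i ∈ [1 : 2^k - 1]`, and otherwise
`h_k(2^k)` followed by the uncompressed phrase. -/
def phraseCode {A B : Type*} [Fintype A] (L : ℕ) (x : ℤ → A) (y : ℤ → B) (i : ℕ) : List Bool :=
  if 1 ≤ matchCount L x y i ∧ matchCount L x y i ≤ 2 ^ rawBits A L - 1 then
    intCode (rawBits A L) (matchCount L x y i)
  else
    intCode (rawBits A L) (2 ^ rawBits A L) ++ rawCode (block L x (phraseStart L i))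

/-- The whole codeword of `N ≥ 1` phrases of length `L`, `w(x_1^{NL} | y_1^{NL})`: the uncompressed
first phrase followed by the codewords of the phrases `2, …, N`. Only the coordinates `1, …, NL`
of `x` and `y` are read. -/
def codeword {A B : Type*} [Fintype A] (N L : ℕ) (x : ℤ → A) (y : ℤ → B) : List Bool :=
  rawCode (block L x 1) ++ (List.range' 2 (N - 1)).flatMap fun i => phraseCode L x y i

/-- The random codelength `ℓ(w(X_1^{NL} | Y_1^{NL}))`. -/
def codeLength {Ω A B : Type*} [Fintype A] (X : ℤ → Ω → A) (Y : ℤ → Ω → B) (N L : ℕ) (ω : Ω) : ℝ :=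
  ((codeword N L (fun j => X j ω) (fun j => Y j ω)).length : ℝ)

end SideInfoLZ

end

/-!
Write `H_n = H(X_1^n | Y_1^n)`. The iterated limit of the expected codelength per symbol is shown to
equal the conditional entropy rate; both directions are elementary and need no ergodicity.

*Reduction.* Everything is carried out for the law `P` of the pair process on `ℤ → A × B`, which is
invariant under `shift`. `H_n` is subadditive (`subadditive_blockEntropy`, from Gibbs' inequality
`condEntropy_le_sum`), so `H_n / n` converges to some `h` by Fekete's lemma. Up to a header of
`O(log L)` bits, the length of a phrase is `cost k n`, where `n` is the count `returnCount` of
`y`-matches up to the first joint match within the available past. By stationarity the phrase may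
be moved to the position `1`; as the past grows, the count is eventually constant, and dominated
convergence and Cesàro averages give the limit `R L` over the number of phrases.

*Upper bound.* Kac's lemma with side information (`integral_indicator_returnCount_le`) says that
the count, averaged over the event that the joint block is `(u, v)`, is at most `P(v)`. Concavity of
the logarithm then bounds the expected cost by `H_L` up to the probability that there is no match,
which vanishes by Poincaré recurrence (`tendsto_measureReal_returnTime_eq_zero`). Hence
`R L ≤ H_L / L + o(1)`.

*Lower bound.* Given the past and the side information, the count determines the phrase
(`eq_of_returnCount_eq`), so the codelengths satisfy Kraft's inequality for every fixed side
information (`kraft_codeword`). Gibbs' inequality gives `H_{NL} ≤ E ℓ`, hence `h ≤ R L` for every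
`L ≥ 1`. The lower bound is what makes the outer limit exist.
-/

namespace SideInfoLZ

/-! ### Return times and codelengths -/

/-- The least offset `t ∈ [1, T]` at which the block of `z` of length `L` at position `a` has
occurred before; it is `0` if there is none. -/
noncomputable def returnTime {S : Type*} (L T : ℕ) (z : ℤ → S) (a : ℤ) : ℕ :=
  sInf {t : ℕ | 0 < t ∧ t ≤ T ∧ block L z a = block L z (a - t)}

open Classical in
/-- The number of occurrences of the `B`-block at position `a`, counted backwards up to the first
return of the joint block; it is `0` if there is no such return within the window of length `T`. -/
noncomputable def returnCount {A B : Type*} (L T : ℕ) (z : ℤ → A × B) (a : ℤ) : ℕ :=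
  if 0 < returnTime L T z a then
    ((Finset.Icc 1 (returnTime L T z a)).filter fun t : ℕ =>
      block L (fun j => (z j).2) a = block L (fun j => (z j).2) (a - t)).card
  else 0

/-- The part of the codelength of a phrase that depends on its count `n`: the number of binary
digits of `n` below the leading one, or the `k` bits of the uncompressed phrase. -/
def cost (k n : ℕ) : ℕ := if 1 ≤ n ∧ n ≤ 2 ^ k - 1 then Nat.log 2 n else k

theorem cost_le (k n : ℕ) : cost k n ≤ k := by
  unfold cost
  split_ifs with h
  · exact (Nat.log_lt_of_lt_pow (by omega) (by have := Nat.two_pow_pos k; omega)).le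
  · exact le_rfl

theorem matchCount_eq_returnCount {A B : Type*} (L : ℕ) (x : ℤ → A) (y : ℤ → B) (i : ℕ) :
    matchCount L x y i =
      returnCount L ((i - 1) * L) (fun j => (x j, y j)) (phraseStart L i) := by
  have h : matchOffset L x y i =
      returnTime L ((i - 1) * L) (fun j => (x j, y j)) (phraseStart L i) := by
    simp [matchOffset, returnTime, IsMatch]
  unfold matchCount returnCount
  rw [h]
  congr 2
  ext t
  simp only [Finset.mem_filter]
  rfl

theorem length_rawCode {A : Type*} [Fintype A] {L : ℕ} (u : Fin L → A) :
    (rawCode u).length = rawBits A L := length_bits _ _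

theorem length_phraseCode {A B : Type*} [Fintype A] (L : ℕ) (x : ℤ → A) (y : ℤ → B) (i : ℕ) :
    (phraseCode L x y i).length =
      Nat.clog 2 (1 + rawBits A L) + cost (rawBits A L) (matchCount L x y i) := by
  have h2 := Nat.two_pow_pos (rawBits A L)
  unfold phraseCode cost
  split_ifs with h
  · rw [length_intCode, if_pos (by omega)]
  · rw [List.length_append, length_intCode, if_neg (lt_irrefl _), length_rawCode]

theorem length_codeword {A B : Type*} [Fintype A] (N L : ℕ) (x : ℤ → A) (y : ℤ → B) :
    (codeword N L x y).length = rawBits A L + ∑ m ∈ Finset.range (N - 1),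
      (Nat.clog 2 (1 + rawBits A L) + cost (rawBits A L)
        (returnCount L ((m + 1) * L) (fun j => (x j, y j)) (((m + 1) * L : ℕ) + 1))) := by
  rw [codeword, List.length_append, length_rawCode, List.length_flatMap]
  congr 1
  rw [List.range'_eq_map_range, List.map_map, Finset.sum_range]
  rw [← List.sum_ofFn, List.ofFn_eq_map, ← List.map_coe_finRange_eq_range, List.map_map]
  congr 1
  refine List.map_congr_left fun m _ => ?_
  have h1 : 2 + (m : ℕ) - 1 = m + 1 := by omega
  simp only [Function.comp_apply, length_phraseCode, matchCount_eq_returnCount, h1, phraseStart]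
  congr 3
  push_cast
  ring

theorem block_congr {S : Type*} {L : ℕ} {z z' : ℤ → S} {a : ℤ}
    (h : ∀ j, a ≤ j → j < a + L → z j = z' j) : block L z a = block L z' a := by
  funext j
  exact h _ (by omega) (by have := j.2; omega)

theorem returnTime_congr {S : Type*} {L T : ℕ} {z z' : ℤ → S} {a : ℤ}
    (h : ∀ j, a - T ≤ j → j < a + L → z j = z' j) : returnTime L T z a = returnTime L T z' a := by
  unfold returnTime
  congr 1
  ext t
  refine and_congr_right fun h0 => and_congr_right fun hT => ?_
  rw [block_congr (z := z) (z' := z') (a := a) fun j _ _ => h j (by omega) (by omega),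
    block_congr (z := z) (z' := z') (a := a - t) fun j _ _ => h j (by omega) (by omega)]

theorem returnTime_le {S : Type*} (L T : ℕ) (z : ℤ → S) (a : ℤ) : returnTime L T z a ≤ T := by
  rcases Nat.eq_zero_or_pos (returnTime L T z a) with h | h
  · omega
  · exact (Nat.sInf_mem (Nat.nonempty_of_pos_sInf h)).2.1

theorem block_sub_returnTime {S : Type*} {L T : ℕ} {z : ℤ → S} {a : ℤ}
    (h : 0 < returnTime L T z a) :
    block L z a = block L z (a - returnTime L T z a) :=
  (Nat.sInf_mem (Nat.nonempty_of_pos_sInf h)).2.2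

theorem block_ne_of_lt_returnTime {S : Type*} {L T : ℕ} {z : ℤ → S} {a : ℤ} {t : ℕ}
    (h0 : 0 < t) (h : t < returnTime L T z a) : block L z (a - t) ≠ block L z a := fun he =>
  Nat.notMem_of_lt_sInf h ⟨h0, h.le.trans (returnTime_le L T z a), he.symm⟩

theorem block_ne_of_returnTime_eq_zero {S : Type*} {L T : ℕ} {z : ℤ → S} {a : ℤ} {t : ℕ}
    (h : returnTime L T z a = 0) (h0 : 0 < t) (hT : t ≤ T) : block L z (a - t) ≠ block L z a := by
  intro he
  rcases Nat.sInf_eq_zero.1 h with h | h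
  · exact absurd h.1 (lt_irrefl _)
  · exact (h ▸ Set.notMem_empty t : t ∉ {t : ℕ | 0 < t ∧ t ≤ T ∧ block L z a = block L z (a - t)})
      ⟨h0, hT, he.symm⟩

theorem block_snd {A B : Type*} {L : ℕ} {z z' : ℤ → A × B} {a b : ℤ}
    (h : block L z a = block L z' b) :
    block L (fun j => (z j).2) a = block L (fun j => (z' j).2) b := by
  funext j
  exact congrArg Prod.snd (congrFun h j)

theorem returnCount_congr {A B : Type*} {L T : ℕ} {z z' : ℤ → A × B} {a : ℤ}
    (h : ∀ j, a - T ≤ j → j < a + L → z j = z' j) :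
    returnCount L T z a = returnCount L T z' a := by
  unfold returnCount
  rw [returnTime_congr h]
  congr 2
  ext t
  simp only [Finset.mem_filter]
  refine and_congr_right fun ht => ?_
  have := (Finset.mem_Icc.1 ht).2.trans (returnTime_le L T z' a)
  rw [block_congr (z := fun j => (z j).2) (z' := fun j => (z' j).2) (a := a)
      fun j _ _ => congrArg Prod.snd (h j (by omega) (by omega)),
    block_congr (z := fun j => (z j).2) (z' := fun j => (z' j).2) (a := a - t)
      fun j _ _ => congrArg Prod.snd (h j (by omega) (by omega))]

theorem length_codeword_congr {A B : Type*} [Fintype A] {N L : ℕ} {x x' : ℤ → A} {y y' : ℤ → B}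
    (hx : ∀ j : ℤ, 1 ≤ j → j ≤ (N * L : ℕ) → x j = x' j)
    (hy : ∀ j : ℤ, 1 ≤ j → j ≤ (N * L : ℕ) → y j = y' j) :
    (codeword N L x y).length = (codeword N L x' y').length := by
  rw [length_codeword, length_codeword]
  congr 1
  refine Finset.sum_congr rfl fun m hm => ?_
  rw [returnCount_congr (z := fun j => (x j, y j)) (z' := fun j => (x' j, y' j))]
  intro j h1 h2
  have hm' : m + 2 ≤ N := by have := Finset.mem_range.1 hm; omega
  have hL : (m + 1) * L + L ≤ N * L := by
    calc (m + 1) * L + L = (m + 2) * L := by ring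
      _ ≤ N * L := Nat.mul_le_mul_right L hm'
  rw [hx j (by omega) (by omega), hy j (by omega) (by omega)]

/-! ### The Kraft inequality -/

theorem card_filter_Icc_lt {P : ℕ → Prop} [DecidablePred P] {s s' : ℕ} (h : s < s') (hP : P s') :
    ((Finset.Icc 1 s).filter P).card < ((Finset.Icc 1 s').filter P).card := by
  refine Finset.card_lt_card ((Finset.ssubset_iff_of_subset ?_).2 ⟨s', ?_, ?_⟩)
  · exact Finset.filter_subset_filter _ (Finset.Icc_subset_Icc_right h.le)
  · simp [hP]; omega
  · simp; omega

/-- The count `n` determines the phrase, given the past and the side information. -/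
theorem eq_of_returnCount_eq {A B : Type*} {L T : ℕ} {z z' : ℤ → A × B} {a : ℤ}
    (hpast : ∀ j < a, z j = z' j) (hsnd : ∀ j, (z j).2 = (z' j).2)
    (hpos : 1 ≤ returnCount L T z a) (heq : returnCount L T z a = returnCount L T z' a) :
    block L z a = block L z' a := by
  classical
  have hs : 0 < returnTime L T z a := by
    by_contra h
    rw [returnCount, if_neg h] at hpos
    omega
  have hs' : 0 < returnTime L T z' a := by
    by_contra h
    rw [heq, returnCount, if_neg h] at hpos
    omega
  have hb := block_sub_returnTime hs
  have hb' := block_sub_returnTime hs'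
  have h2 : (fun j => (z' j).2) = fun j => (z j).2 := funext fun j => (hsnd j).symm
  have hcount := heq
  rw [returnCount, returnCount, if_pos hs, if_pos hs', h2] at hcount
  -- A return time is itself an offset of a match of the side information, so that two different
  -- return times would give different counts.
  have hst : returnTime L T z a = returnTime L T z' a := by
    rcases lt_trichotomy (returnTime L T z a) (returnTime L T z' a) with h | h | h
    · refine absurd hcount (ne_of_lt (card_filter_Icc_lt h ?_))
      rw [← h2]
      exact block_snd hb'
    · exact h
    · exact absurd hcount (ne_of_gt (card_filter_Icc_lt h (block_snd hb)))
  -- The block may overlap its earlier occurrence, so it is recovered symbol by symbol.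
  have key : ∀ j : ℕ, j < L → z (a + j) = z' (a + j) := by
    intro j
    induction j using Nat.strong_induction_on with
    | _ j ih =>
      intro hj
      have e : z (a + j) = z (a - returnTime L T z a + j) := congrFun hb ⟨j, hj⟩
      have e' : z' (a + j) = z' (a - returnTime L T z a + j) := by
        rw [hst]; exact congrFun hb' ⟨j, hj⟩
      rw [e, e']
      rcases lt_or_ge j (returnTime L T z a) with h | h
      · exact hpast _ (by omega)
      · have := ih (j - returnTime L T z a) (by omega) (by omega)
        rwa [Nat.cast_sub h, show a + ((j : ℤ) - returnTime L T z a) =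
          a - returnTime L T z a + j by ring] at this
  funext j
  exact key j j.2

theorem sum_half_pow_log (k : ℕ) :
    ∑ n ∈ Finset.Ico 1 (2 ^ k), (1 / 2 : ℝ) ^ Nat.log 2 n = k := by
  induction k with
  | zero => simp
  | succ k ih =>
    rw [← Finset.sum_Ico_consecutive _ (Nat.one_le_two_pow (n := k))
      (Nat.pow_le_pow_right (by norm_num) (Nat.le_succ k)), ih]
    rw [Finset.sum_congr rfl (g := fun _ => (1 / 2 : ℝ) ^ k)]
    · rw [Finset.sum_const, Nat.card_Ico, nsmul_eq_mul,
        show 2 ^ (k + 1) - 2 ^ k = 2 ^ k by rw [pow_succ]; omega]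
      push_cast
      rw [← mul_pow]
      norm_num
    · intro n hn
      rw [Finset.mem_Ico] at hn
      rw [Nat.log_eq_of_pow_le_of_lt_pow hn.1 hn.2]

theorem card_pow_le_two_pow_rawBits (A : Type*) [Fintype A] [Nonempty A] (L : ℕ) :
    (Fintype.card A : ℝ) ^ L ≤ 2 ^ rawBits A L := by
  have hA : (0 : ℝ) < Fintype.card A := by exact_mod_cast Fintype.card_pos
  have h := Nat.le_ceil ((L : ℝ) * Real.logb 2 (Fintype.card A))
  calc (Fintype.card A : ℝ) ^ L
      = 2 ^ ((L : ℝ) * Real.logb 2 (Fintype.card A)) := by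
        rw [mul_comm, Real.rpow_mul (by norm_num),
          Real.rpow_logb (by norm_num) (by norm_num) hA, Real.rpow_natCast]
    _ ≤ (2 : ℝ) ^ ((rawBits A L : ℕ) : ℝ) :=
        Real.rpow_le_rpow_of_exponent_le (by norm_num) h
    _ = 2 ^ rawBits A L := Real.rpow_natCast _ _

theorem sum_half_pow_rawBits_le (A : Type*) [Fintype A] [Nonempty A] (L : ℕ) :
    ∑ _v : Fin L → A, (1 / 2 : ℝ) ^ rawBits A L ≤ 1 := by
  have h := card_pow_le_two_pow_rawBits A L
  rw [Finset.sum_const, Finset.card_univ, Fintype.card_fun, Fintype.card_fin, nsmul_eq_mul,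
    one_div, inv_pow, ← div_eq_mul_inv]
  push_cast
  exact (div_le_one (by positivity)).2 h

/-- Kraft's inequality for one phrase: a family of counts `n v ∈ ℕ` that determine the phrase `v`
unless they are `0`. The header contributes `1 / (1 + k)`, which pays for the `k` dyadic ranges of
the count and for the uncompressed phrases. -/
theorem kraft_phrase {A : Type*} [Fintype A] [Nonempty A] {L : ℕ} (n : (Fin L → A) → ℕ)
    (hn : ∀ v v', 1 ≤ n v → n v = n v' → v = v') :
    ∑ v, (1 / 2 : ℝ) ^ (Nat.clog 2 (1 + rawBits A L) + cost (rawBits A L) (n v)) ≤ 1 := by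
  classical
  set k := rawBits A L
  have h2 := Nat.two_pow_pos k
  have h1 : ∑ v, (1 / 2 : ℝ) ^ cost k (n v) ≤ k + 1 := by
    rw [← Finset.sum_filter_add_sum_filter_not _ fun v => 1 ≤ n v ∧ n v ≤ 2 ^ k - 1]
    refine add_le_add ?_ ?_
    · calc ∑ v with 1 ≤ n v ∧ n v ≤ 2 ^ k - 1, (1 / 2 : ℝ) ^ cost k (n v)
          = ∑ v with 1 ≤ n v ∧ n v ≤ 2 ^ k - 1, (1 / 2 : ℝ) ^ Nat.log 2 (n v) := by
            refine Finset.sum_congr rfl fun v hv => ?_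
            rw [cost, if_pos (Finset.mem_filter.1 hv).2]
        _ = ∑ j ∈ (Finset.univ.filter fun v => 1 ≤ n v ∧ n v ≤ 2 ^ k - 1).image n,
              (1 / 2 : ℝ) ^ Nat.log 2 j := by
            rw [Finset.sum_image]
            intro v hv v' _ he
            exact hn v v' (Finset.mem_filter.1 hv).2.1 he
        _ ≤ ∑ j ∈ Finset.Ico 1 (2 ^ k), (1 / 2 : ℝ) ^ Nat.log 2 j := by
            refine Finset.sum_le_sum_of_subset_of_nonneg ?_ fun _ _ _ => by positivity
            intro j hj
            obtain ⟨v, hv, rfl⟩ := Finset.mem_image.1 hj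
            have := (Finset.mem_filter.1 hv).2
            rw [Finset.mem_Ico]
            omega
        _ = k := sum_half_pow_log k
    · calc ∑ v with ¬(1 ≤ n v ∧ n v ≤ 2 ^ k - 1), (1 / 2 : ℝ) ^ cost k (n v)
          = ∑ v with ¬(1 ≤ n v ∧ n v ≤ 2 ^ k - 1), (1 / 2 : ℝ) ^ k := by
            refine Finset.sum_congr rfl fun v hv => ?_
            rw [cost, if_neg (Finset.mem_filter.1 hv).2]
        _ ≤ ∑ _v : Fin L → A, (1 / 2 : ℝ) ^ k :=
            Finset.sum_le_sum_of_subset_of_nonneg (Finset.filter_subset _ _)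
              fun _ _ _ => by positivity
        _ ≤ 1 := sum_half_pow_rawBits_le A L
  have h3 : (1 + k : ℝ) ≤ 2 ^ Nat.clog 2 (1 + k) := by
    exact_mod_cast Nat.le_pow_clog (by norm_num) (1 + k)
  simp_rw [pow_add, ← Finset.mul_sum]
  calc (1 / 2 : ℝ) ^ Nat.clog 2 (1 + k) * ∑ v, (1 / 2 : ℝ) ^ cost k (n v)
      ≤ (1 / 2 : ℝ) ^ Nat.clog 2 (1 + k) * 2 ^ Nat.clog 2 (1 + k) := by gcongr; linarith
    _ = 1 := by rw [← mul_pow]; norm_num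

/-- The doubly infinite sequence that carries the word `u` at the positions `1, …, n`; its other
symbols are arbitrary. -/
noncomputable def extend {S : Type*} [Nonempty S] {n : ℕ} (u : Fin n → S) (j : ℤ) : S :=
  if h : 1 ≤ j ∧ j ≤ n then u ⟨(j - 1).toNat, by omega⟩ else Classical.arbitrary S

theorem extend_block {S : Type*} [Nonempty S] {n : ℕ} (x : ℤ → S) {j : ℤ} (h1 : 1 ≤ j)
    (h2 : j ≤ n) : extend (block n x 1) j = x j := by
  rw [extend, dif_pos ⟨h1, h2⟩, block]
  congr 1
  simp only
  omega

theorem extend_append_left {S : Type*} [Nonempty S] {m n : ℕ} (u : Fin m → S) (v : Fin n → S)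
    {j : ℤ} (h : j ≤ m) : extend (Fin.append u v) j = extend u j := by
  unfold extend
  by_cases h1 : 1 ≤ j
  · rw [dif_pos ⟨h1, by omega⟩, dif_pos ⟨h1, h⟩]
    exact Fin.append_left u v ⟨(j - 1).toNat, by omega⟩
  · rw [dif_neg (by omega), dif_neg (by omega)]

theorem block_extend_append {S : Type*} [Nonempty S] {m n : ℕ} (u : Fin m → S) (v : Fin n → S) :
    block n (extend (Fin.append u v)) (m + 1) = v := by
  funext j
  have := j.2
  rw [block, extend, dif_pos (by push_cast; omega)]
  rw [← Fin.append_right u v j]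
  congr 1
  ext
  simp only [Fin.val_natAdd]
  omega

theorem length_codeword_succ {A B : Type*} [Fintype A] {N : ℕ} (hN : 1 ≤ N) (L : ℕ) (x : ℤ → A)
    (y : ℤ → B) : (codeword (N + 1) L x y).length = (codeword N L x y).length +
      (Nat.clog 2 (1 + rawBits A L) + cost (rawBits A L)
        (returnCount L (N * L) (fun j => (x j, y j)) ((N * L : ℕ) + 1))) := by
  obtain ⟨M, rfl⟩ : ∃ M, N = M + 1 := ⟨N - 1, by omega⟩
  rw [length_codeword, length_codeword, Nat.add_sub_cancel, Nat.add_sub_cancel,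
    Finset.sum_range_succ, add_assoc]

/-- Kraft's inequality for the whole code: for every fixed side information `y`, the codelengths
satisfy `∑ 2 ^ (-ℓ) ≤ 1`, the sum over all words of length `m = N L`. -/
theorem kraft_codeword {A B : Type*} [Fintype A] [Nonempty A] {N : ℕ} (hN : 1 ≤ N) (L : ℕ)
    (y : ℤ → B) (m : ℕ) (hm : m = N * L) :
    ∑ u : Fin m → A, (1 / 2 : ℝ) ^ (codeword N L (extend u) y).length ≤ 1 := by
  induction N, hN using Nat.le_induction generalizing m with
  | base =>
    obtain rfl : m = L := by omega
    simp_rw [length_codeword]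
    simpa using sum_half_pow_rawBits_le A m
  | succ N hN ih =>
    obtain rfl : m = N * L + L := by rw [hm]; ring
    rw [← (Fin.appendEquiv (N * L) L).sum_comp, Fintype.sum_prod_type]
    refine le_trans (Finset.sum_le_sum fun u _ => ?_) (ih (N * L) rfl)
    simp only [Fin.appendEquiv, Equiv.coe_fn_mk]
    have h1 : ∀ v : Fin L → A, (codeword N L (extend (Fin.append u v)) y).length =
        (codeword N L (extend u) y).length := fun v =>
      length_codeword_congr (fun j _ hj => extend_append_left u v hj) fun _ _ _ => rfl
    simp_rw [length_codeword_succ hN, h1, pow_add _ (codeword N L (extend u) y).length,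
      ← Finset.mul_sum]
    refine mul_le_of_le_one_right (by positivity) (kraft_phrase _ fun v v' hv he => ?_)
    have h2 := eq_of_returnCount_eq (z := fun j => (extend (Fin.append u v) j, y j))
      (z' := fun j => (extend (Fin.append u v') j, y j)) (fun j hj => ?_) (fun j => rfl) hv he
    · rw [← block_extend_append u v, ← block_extend_append u v']
      funext j
      exact congrArg Prod.fst (congrFun h2 j)
    · rw [extend_append_left u v (Int.lt_add_one_iff.1 hj),
        extend_append_left u v' (Int.lt_add_one_iff.1 hj)]

/-! ### Conditional entropy -/

section Entropy

variable {Ω U V : Type*} [MeasurableSpace Ω]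
  {μ : Measure Ω} {F : Ω → U} {G : Ω → V}

theorem measureReal_fiber_le [IsFiniteMeasure μ] (u : U) (v : V) :
    μ.real {ω | F ω = u ∧ G ω = v} ≤ μ.real {ω | G ω = v} :=
  measureReal_mono fun _ h => h.2

theorem measurableSet_fiber (hF : ∀ u, MeasurableSet {ω | F ω = u})
    (hG : ∀ v, MeasurableSet {ω | G ω = v}) (u : U) (v : V) :
    MeasurableSet {ω | F ω = u ∧ G ω = v} := (hF u).inter (hG v)

variable [Fintype U]

theorem sum_measureReal_fiber [IsFiniteMeasure μ] (hF : ∀ u, MeasurableSet {ω | F ω = u})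
    (hG : ∀ v, MeasurableSet {ω | G ω = v}) (v : V) :
    ∑ u, μ.real {ω | F ω = u ∧ G ω = v} = μ.real {ω | G ω = v} := by
  rw [← measureReal_biUnion_finset (fun u _ u' _ h => ?_)
    fun u _ => measurableSet_fiber hF hG u v]
  · congr 1
    ext ω
    simp
  · rw [Function.onFun, Set.disjoint_left]
    exact fun ω h1 h2 => h (h1.1.symm.trans h2.1)

variable [Fintype V]

theorem comp_eq_sum_indicator {Ω U V : Type*} [Fintype U] [Fintype V] (F : Ω → U) (G : Ω → V)
    (ψ : U → V → ℝ) (ω : Ω) :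
    ψ (F ω) (G ω) = ∑ u, ∑ v, {ω | F ω = u ∧ G ω = v}.indicator (fun _ => ψ u v) ω := by
  classical
  rw [Finset.sum_eq_single (F ω), Finset.sum_eq_single (G ω)]
  · simp
  · intro v _ hv
    simp [hv.symm]
  · simp
  · intro u _ hu
    simp [hu.symm]
  · simp

theorem integrable_comp_fiber [IsFiniteMeasure μ] (hF : ∀ u, MeasurableSet {ω | F ω = u})
    (hG : ∀ v, MeasurableSet {ω | G ω = v}) (ψ : U → V → ℝ) :
    Integrable (fun ω => ψ (F ω) (G ω)) μ := by
  simp_rw [comp_eq_sum_indicator F G ψ]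
  exact integrable_finsetSum _ fun u _ => integrable_finsetSum _ fun v _ =>
    (integrable_const _).indicator (measurableSet_fiber hF hG u v)

theorem sum_measureReal_mul [IsFiniteMeasure μ] (hF : ∀ u, MeasurableSet {ω | F ω = u})
    (hG : ∀ v, MeasurableSet {ω | G ω = v}) (ψ : U → V → ℝ) :
    ∑ u, ∑ v, μ.real {ω | F ω = u ∧ G ω = v} * ψ u v = ∫ ω, ψ (F ω) (G ω) ∂μ := by
  simp_rw [comp_eq_sum_indicator F G ψ]
  have hi : ∀ u v, Integrable ({ω | F ω = u ∧ G ω = v}.indicator fun _ => ψ u v) μ := fun u v =>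
    (integrable_const _).indicator (measurableSet_fiber hF hG u v)
  rw [integral_finsetSum _ fun u _ => integrable_finsetSum _ fun v _ => hi u v]
  refine Finset.sum_congr rfl fun u _ => ?_
  rw [integral_finsetSum _ fun v _ => hi u v]
  refine Finset.sum_congr rfl fun v _ => ?_
  rw [integral_indicator_const _ (measurableSet_fiber hF hG u v), smul_eq_mul]

theorem condEntropy_eq_integral [IsFiniteMeasure μ] (hF : ∀ u, MeasurableSet {ω | F ω = u})
    (hG : ∀ v, MeasurableSet {ω | G ω = v}) :
    condEntropy μ F G = ∫ ω, Real.logb 2 (μ.real {ω' | G ω' = G ω} /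
      μ.real {ω' | F ω' = F ω ∧ G ω' = G ω}) ∂μ :=
  sum_measureReal_mul hF hG fun u v =>
    Real.logb 2 (μ.real {ω | G ω = v} / μ.real {ω | F ω = u ∧ G ω = v})

theorem condEntropy_nonneg [IsFiniteMeasure μ] : 0 ≤ condEntropy μ F G := by
  refine Finset.sum_nonneg fun u _ => Finset.sum_nonneg fun v _ => ?_
  rcases (measureReal_nonneg (μ := μ) (s := {ω | F ω = u ∧ G ω = v})).eq_or_lt with h | h
  · rw [← h, zero_mul]
  · exact mul_nonneg h.le (Real.logb_nonneg (by norm_num)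
      ((one_le_div h).2 (measureReal_fiber_le u v)))

/-- Gibbs' inequality: for every family `q (· , v)` of sub-probability weights, the conditional
entropy is at most the expectation of `-log₂ q`. -/
theorem condEntropy_le_sum [IsFiniteMeasure μ] (hF : ∀ u, MeasurableSet {ω | F ω = u})
    (hG : ∀ v, MeasurableSet {ω | G ω = v}) (q ψ : U → V → ℝ) (hq0 : ∀ u v, 0 ≤ q u v)
    (hq : ∀ v, ∑ u, q u v ≤ 1)
    (hψ : ∀ u v, 0 < μ.real {ω | F ω = u ∧ G ω = v} →
      0 < q u v ∧ -Real.logb 2 (q u v) ≤ ψ u v) :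
    condEntropy μ F G ≤ ∑ u, ∑ v, μ.real {ω | F ω = u ∧ G ω = v} * ψ u v := by
  have hlog : 0 < Real.log 2 := Real.log_pos (by norm_num)
  have hterm : ∀ u v, μ.real {ω | F ω = u ∧ G ω = v} *
      Real.logb 2 (μ.real {ω | G ω = v} / μ.real {ω | F ω = u ∧ G ω = v}) ≤
      μ.real {ω | F ω = u ∧ G ω = v} * ψ u v +
      (μ.real {ω | G ω = v} * q u v - μ.real {ω | F ω = u ∧ G ω = v}) / Real.log 2 := by
    intro u v
    have hle := measureReal_fiber_le (μ := μ) (F := F) (G := G) u v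
    have hψ' := hψ u v
    have hp0 : 0 ≤ μ.real {ω | F ω = u ∧ G ω = v} := measureReal_nonneg
    generalize μ.real {ω | F ω = u ∧ G ω = v} = p at *
    generalize μ.real {ω | G ω = v} = P at *
    rcases hp0.lt_or_eq with hp | rfl
    · obtain ⟨hq', hψ'⟩ := hψ' hp
      have hP : 0 < P := hp.trans_le hle
      have h1 : Real.logb 2 (P / p) = Real.logb 2 (P * q u v / p) - Real.logb 2 (q u v) := by
        rw [mul_div_right_comm, Real.logb_mul (by positivity) hq'.ne']
        ring
      have h2 : p * Real.logb 2 (P * q u v / p) ≤ (P * q u v - p) / Real.log 2 := by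
        rw [Real.logb, ← mul_div_assoc]
        refine div_le_div_of_nonneg_right ?_ hlog.le
        calc p * Real.log (P * q u v / p) ≤ p * (P * q u v / p - 1) :=
              mul_le_mul_of_nonneg_left (Real.log_le_sub_one_of_pos (by positivity)) hp.le
          _ = P * q u v - p := by field_simp
      have h3 := mul_le_mul_of_nonneg_left hψ' hp.le
      rw [h1]
      linarith
    · have := div_nonneg (mul_nonneg hle (hq0 u v)) hlog.le
      simpa using this
  have hsum : ∑ u, ∑ v, (μ.real {ω | G ω = v} * q u v - μ.real {ω | F ω = u ∧ G ω = v}) /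
      Real.log 2 ≤ 0 := by
    rw [Finset.sum_comm]
    refine Finset.sum_nonpos fun v _ => ?_
    rw [← Finset.sum_div, Finset.sum_sub_distrib, ← Finset.mul_sum, sum_measureReal_fiber hF hG]
    refine div_nonpos_of_nonpos_of_nonneg ?_ hlog.le
    have := mul_le_mul_of_nonneg_left (hq v) (measureReal_nonneg (μ := μ) (s := {ω | G ω = v}))
    linarith
  have h := Finset.sum_le_sum fun u (_ : u ∈ Finset.univ) =>
    Finset.sum_le_sum fun v (_ : v ∈ Finset.univ) => hterm u v
  simp_rw [Finset.sum_add_distrib] at h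
  exact h.trans (by linarith)

theorem condEntropy_map {Ω' : Type*} [MeasurableSpace Ω'] {T : Ω' → Ω} {ν : Measure Ω'}
    (hT : Measurable T) (hF : ∀ u, MeasurableSet {ω | F ω = u})
    (hG : ∀ v, MeasurableSet {ω | G ω = v}) :
    condEntropy (ν.map T) F G = condEntropy ν (fun ω => F (T ω)) (fun ω => G (T ω)) := by
  unfold condEntropy
  refine Finset.sum_congr rfl fun u _ => Finset.sum_congr rfl fun v _ => ?_
  rw [map_measureReal_apply hT (measurableSet_fiber hF hG u v), map_measureReal_apply hT (hG v)]
  rfl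

theorem condEntropy_comp_equiv {U' V' : Type*} [Fintype U'] [Fintype V'] (e : U ≃ U')
    (e' : V ≃ V') :
    condEntropy μ (fun ω => e (F ω)) (fun ω => e' (G ω)) = condEntropy μ F G := by
  unfold condEntropy
  refine (Fintype.sum_equiv e _ _ fun u => Fintype.sum_equiv e' _ _ fun v => ?_).symm
  simp only [EmbeddingLike.apply_eq_iff_eq]

/-- Subadditivity of the conditional entropy, from Gibbs' inequality for the product of the
conditional laws of the two components. -/
theorem condEntropy_prod_le [IsFiniteMeasure μ] {U' V' : Type*} [Fintype U'] [Fintype V']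
    {F' : Ω → U'} {G' : Ω → V'}
    (hF : ∀ u, MeasurableSet {ω | F ω = u}) (hG : ∀ v, MeasurableSet {ω | G ω = v})
    (hF' : ∀ u, MeasurableSet {ω | F' ω = u}) (hG' : ∀ v, MeasurableSet {ω | G' ω = v}) :
    condEntropy μ (fun ω => (F ω, F' ω)) (fun ω => (G ω, G' ω)) ≤
      condEntropy μ F G + condEntropy μ F' G' := by
  have hFF : ∀ u : U × U', MeasurableSet {ω | (F ω, F' ω) = u} := fun u => by
    simpa only [Prod.ext_iff] using measurableSet_fiber hF hF' u.1 u.2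
  have hGG : ∀ v : V × V', MeasurableSet {ω | (G ω, G' ω) = v} := fun v => by
    simpa only [Prod.ext_iff] using measurableSet_fiber hG hG' v.1 v.2
  have hle : ∀ (v : V), ∑ u, μ.real {ω | F ω = u ∧ G ω = v} / μ.real {ω | G ω = v} ≤ 1 :=
    fun v => by
      rw [← Finset.sum_div, sum_measureReal_fiber hF hG]
      exact div_self_le_one _
  have hle' : ∀ (v : V'), ∑ u, μ.real {ω | F' ω = u ∧ G' ω = v} / μ.real {ω | G' ω = v} ≤ 1 :=
    fun v => by
      rw [← Finset.sum_div, sum_measureReal_fiber hF' hG']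
      exact div_self_le_one _
  refine (condEntropy_le_sum hFF hGG
    (fun u v => μ.real {ω | F ω = u.1 ∧ G ω = v.1} / μ.real {ω | G ω = v.1} *
      (μ.real {ω | F' ω = u.2 ∧ G' ω = v.2} / μ.real {ω | G' ω = v.2}))
    (fun u v => Real.logb 2 (μ.real {ω | G ω = v.1} / μ.real {ω | F ω = u.1 ∧ G ω = v.1}) +
      Real.logb 2 (μ.real {ω | G' ω = v.2} / μ.real {ω | F' ω = u.2 ∧ G' ω = v.2}))
    (fun u v => by positivity) (fun v => ?_) fun u v hp => ?_).trans_eq ?_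
  · rw [Fintype.sum_prod_type]
    simp only
    rw [← Finset.sum_mul_sum]
    exact mul_le_one₀ (hle _) (Finset.sum_nonneg fun _ _ => by positivity) (hle' _)
  · have h1 : 0 < μ.real {ω | F ω = u.1 ∧ G ω = v.1} :=
      hp.trans_le (measureReal_mono fun ω h => ⟨congrArg Prod.fst h.1, congrArg Prod.fst h.2⟩)
    have h2 : 0 < μ.real {ω | F' ω = u.2 ∧ G' ω = v.2} :=
      hp.trans_le (measureReal_mono fun ω h => ⟨congrArg Prod.snd h.1, congrArg Prod.snd h.2⟩)
    have h1' := h1.trans_le (measureReal_fiber_le u.1 v.1)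
    have h2' := h2.trans_le (measureReal_fiber_le u.2 v.2)
    refine ⟨by positivity, le_of_eq ?_⟩
    rw [Real.logb_mul (by positivity) (by positivity), neg_add, ← Real.logb_inv, ← Real.logb_inv,
      inv_div, inv_div]
  · rw [sum_measureReal_mul hFF hGG, condEntropy_eq_integral hF hG,
      condEntropy_eq_integral hF' hG', ← integral_add]
    · exact integrable_comp_fiber hF hG fun u v =>
        Real.logb 2 (μ.real {ω | G ω = v} / μ.real {ω | F ω = u ∧ G ω = v})
    · exact integrable_comp_fiber hF' hG' fun u v =>
        Real.logb 2 (μ.real {ω | G' ω = v} / μ.real {ω | F' ω = u ∧ G' ω = v})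

end Entropy

/-! ### Stationary measures on path space -/

/-- The time shift by `m` on doubly infinite sequences. -/
def shift {S : Type*} (m : ℤ) (z : ℤ → S) : ℤ → S := fun n => z (n + m)

theorem measurable_shift {S : Type*} [MeasurableSpace S] (m : ℤ) :
    Measurable (shift m : (ℤ → S) → ℤ → S) :=
  measurable_pi_lambda _ fun _ => measurable_pi_apply _

theorem block_shift {S : Type*} (L : ℕ) (m : ℤ) (z : ℤ → S) (a : ℤ) :
    block L (shift m z) a = block L z (a + m) := by
  funext j
  simp only [block, shift]
  congr 1
  ring

/-- A function of finitely many coordinates of a sequence over a finite alphabet is measurable. -/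
theorem measurable_of_eq_on_Icc {S β : Type*} [Finite S] [MeasurableSpace S]
    [MeasurableSingletonClass S] [MeasurableSpace β] {f : (ℤ → S) → β} (a b : ℤ)
    (h : ∀ z z' : ℤ → S, (∀ j, a ≤ j → j ≤ b → z j = z' j) → f z = f z') : Measurable f := by
  rcases isEmpty_or_nonempty β with hβ | hβ
  · exact measurable_of_empty_codomain f
  · obtain ⟨g, rfl⟩ := (dependsOn_iff_exists_comp (f := f) (s := Set.Icc a b)).1
      fun z z' hz => h z z' fun j h1 h2 => hz j ⟨h1, h2⟩
    exact (measurable_of_finite g).comp (measurable_pi_lambda _ fun _ => measurable_pi_apply _)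

theorem returnTime_shift {S : Type*} (L T : ℕ) (m : ℤ) (z : ℤ → S) (a : ℤ) :
    returnTime L T (shift m z) a = returnTime L T z (a + m) := by
  simp only [returnTime, block_shift, sub_add_eq_add_sub]

theorem returnCount_shift {A B : Type*} (L T : ℕ) (m : ℤ) (z : ℤ → A × B) (a : ℤ) :
    returnCount L T (shift m z) a = returnCount L T z (a + m) := by
  have h : ∀ b, block L (fun j => (shift m z j).2) b = block L (fun j => (z j).2) (b + m) :=
    fun b => block_shift L m (fun j => (z j).2) b
  unfold returnCount
  rw [returnTime_shift]
  congr 2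
  ext t
  simp only [Finset.mem_filter, h, sub_add_eq_add_sub]

theorem measurable_block {S : Type*} [MeasurableSpace S] (L : ℕ) (a : ℤ) :
    Measurable fun z : ℤ → S => block L z a :=
  measurable_pi_lambda _ fun _ => measurable_pi_apply _

theorem measurableSet_fst_block {A B : Type*} [MeasurableSpace A]
    [MeasurableSingletonClass A] [MeasurableSpace B] (L : ℕ) (a : ℤ) (u : Fin L → A) :
    MeasurableSet {z : ℤ → A × B | block L (fun j => (z j).1) a = u} :=
  (measurable_pi_lambda (fun (z : ℤ → A × B) => block L (fun j => (z j).1) a) fun _ =>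
    measurable_fst.comp (measurable_pi_apply _)) (measurableSet_singleton u)

theorem measurableSet_snd_block {A B : Type*} [MeasurableSpace A] [MeasurableSpace B]
    [MeasurableSingletonClass B] (L : ℕ) (a : ℤ) (v : Fin L → B) :
    MeasurableSet {z : ℤ → A × B | block L (fun j => (z j).2) a = v} :=
  (measurable_pi_lambda (fun (z : ℤ → A × B) => block L (fun j => (z j).2) a) fun _ =>
    measurable_snd.comp (measurable_pi_apply _)) (measurableSet_singleton v)

/-! ### Kac's lemma and recurrence -/

section Kac

variable {S : Type*} [Finite S] [MeasurableSpace S] [MeasurableSingletonClass S]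

theorem measurable_block_pred {L : ℕ} (Q : (Fin L → S) → Prop) (a : ℤ) :
    Measurable fun z : ℤ → S => Q (block L z a) :=
  (measurable_of_finite Q).comp (measurable_block L a)

theorem measurableSet_return (L : ℕ) (w : Fin L → S) (Q : (Fin L → S) → Prop) (t : ℕ) :
    MeasurableSet {z : ℤ → S | block L z 1 = w ∧ Q (block L z (1 - t)) ∧
      ∀ s : ℕ, 0 < s → s < t → block L z (1 - s) ≠ w} := by
  refine measurableSet_setOfPred.2 ((measurable_block_pred (· = w) 1).and
    ((measurable_block_pred Q _).and (Measurable.forall fun s => ?_)))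
  exact measurable_const.imp (measurable_const.imp (measurable_block_pred (· ≠ w) _))

/-- A form of Kac's lemma. After a shift by `t`, the event in the `t`-th summand says that `Q` holds
for the block at the position `1` and that `w` occurs for the first time at the offset `t` after it;
these events are disjoint. -/
theorem sum_measureReal_return_le {P : Measure (ℤ → S)} [IsFiniteMeasure P]
    (hP : ∀ m, MeasurePreserving (shift m) P P) (L T : ℕ) (w : Fin L → S)
    (Q : (Fin L → S) → Prop) :
    ∑ t ∈ Finset.Icc 1 T, P.real {z | block L z 1 = w ∧ Q (block L z (1 - t)) ∧
      ∀ s : ℕ, 0 < s → s < t → block L z (1 - s) ≠ w} ≤ P.real {z | Q (block L z 1)} := by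
  have hshift : ∀ t : ℕ, P.real {z | block L z 1 = w ∧ Q (block L z (1 - t)) ∧
      ∀ s : ℕ, 0 < s → s < t → block L z (1 - s) ≠ w} =
      P.real (shift (t : ℤ) ⁻¹' {z | block L z 1 = w ∧ Q (block L z (1 - t)) ∧
      ∀ s : ℕ, 0 < s → s < t → block L z (1 - s) ≠ w}) := fun t => by
    rw [measureReal_def, measureReal_def,
      (hP t).measure_preimage (measurableSet_return L w Q t).nullMeasurableSet]
  simp_rw [hshift]
  rw [← measureReal_biUnion_finset]
  · refine measureReal_mono fun z hz => ?_
    simp only [Set.mem_iUnion] at hz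
    obtain ⟨t, -, -, hQ, -⟩ := hz
    rwa [block_shift, sub_add_cancel] at hQ
  · have key : ∀ t t' : ℕ, 1 ≤ t → t < t' → ∀ z : ℤ → S, block L (shift (t : ℤ) z) 1 = w →
        (∀ s : ℕ, 0 < s → s < t' → block L (shift (t' : ℤ) z) (1 - s) ≠ w) → False := by
      intro t t' h1 h2 z hz hz'
      refine hz' (t' - t) (by omega) (by omega) ?_
      rw [← hz, block_shift, block_shift]
      congr 1
      omega
    intro t ht t' ht' hne
    rw [Function.onFun, Set.disjoint_left]
    intro z hz hz'
    have h1 := (Finset.mem_Icc.1 ht).1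
    have h1' := (Finset.mem_Icc.1 ht').1
    rcases lt_or_gt_of_ne hne with h | h
    · exact key t t' h1 h z hz.1 hz'.2.2
    · exact key t' t h1' h z hz'.1 hz.2.2
  · exact fun t _ => (measurable_shift _) (measurableSet_return L w Q t)

/-- Quantitative Poincaré recurrence for blocks. -/
theorem mul_measureReal_returnTime_eq_zero_le {P : Measure (ℤ → S)} [IsProbabilityMeasure P]
    (hP : ∀ m, MeasurePreserving (shift m) P P) (L T : ℕ) :
    T * P.real {z | returnTime L T z 1 = 0} ≤ Nat.card (Fin L → S) := by
  cases nonempty_fintype (Fin L → S)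
  have h1 : P.real {z | returnTime L T z 1 = 0} ≤
      ∑ w : Fin L → S, P.real {z | returnTime L T z 1 = 0 ∧ block L z 1 = w} := by
    refine le_trans (measureReal_mono (fun z hz => ?_) (measure_ne_top _ _))
      (measureReal_biUnion_finset_le _ _)
    simpa using hz
  have h2 : ∀ w : Fin L → S,
      T * P.real {z | returnTime L T z 1 = 0 ∧ block L z 1 = w} ≤ 1 := fun w => by
    have h3 := sum_measureReal_return_le hP L T w fun _ => True
    calc T * P.real {z | returnTime L T z 1 = 0 ∧ block L z 1 = w}
        = ∑ t ∈ Finset.Icc 1 T, P.real {z | returnTime L T z 1 = 0 ∧ block L z 1 = w} := by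
          simp
      _ ≤ _ := by
          refine (Finset.sum_le_sum fun t ht => measureReal_mono fun z hz => ?_).trans h3
          refine ⟨hz.2, trivial, fun s h0 hs => ?_⟩
          rw [← hz.2]
          exact block_ne_of_returnTime_eq_zero hz.1 h0 (hs.le.trans (Finset.mem_Icc.1 ht).2)
      _ ≤ 1 := measureReal_le_one
  calc T * P.real {z | returnTime L T z 1 = 0}
      ≤ T * ∑ w : Fin L → S, P.real {z | returnTime L T z 1 = 0 ∧ block L z 1 = w} := by gcongr
    _ ≤ ∑ w : Fin L → S, (1 : ℝ) := by
        rw [Finset.mul_sum]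
        exact Finset.sum_le_sum fun w _ => h2 w
    _ = Nat.card (Fin L → S) := by simp

theorem tendsto_measureReal_returnTime_eq_zero {P : Measure (ℤ → S)} [IsProbabilityMeasure P]
    (hP : ∀ m, MeasurePreserving (shift m) P P) (L : ℕ) :
    Tendsto (fun T => P.real {z | returnTime L T z 1 = 0}) atTop (𝓝 0) := by
  refine squeeze_zero' (Eventually.of_forall fun _ => measureReal_nonneg) ?_
    (tendsto_const_div_atTop_nhds_zero_nat (Nat.card (Fin L → S) : ℝ))
  filter_upwards [eventually_gt_atTop 0] with T hT
  rw [le_div_iff₀ (by exact_mod_cast hT), mul_comm]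
  exact mul_measureReal_returnTime_eq_zero_le hP L T

end Kac

/-! ### The expected cost of a phrase -/

section Count

variable {A B : Type*}

theorem returnCount_le (L T : ℕ) (z : ℤ → A × B) (a : ℤ) : returnCount L T z a ≤ T := by
  classical
  unfold returnCount
  split_ifs
  · refine (Finset.card_filter_le _ _).trans ?_
    rw [Nat.card_Icc, Nat.add_sub_cancel]
    exact returnTime_le L T z a
  · exact Nat.zero_le T

theorem returnCount_pos {L T : ℕ} {z : ℤ → A × B} {a : ℤ} (h : 0 < returnTime L T z a) :
    0 < returnCount L T z a := by
  classical
  rw [returnCount, if_pos h, Finset.card_pos]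
  exact ⟨_, Finset.mem_filter.2
    ⟨Finset.mem_Icc.2 ⟨h, le_rfl⟩, block_snd (block_sub_returnTime h)⟩⟩

theorem returnTime_eq_of_le {S : Type*} {L T T' : ℕ} {z : ℤ → S} {a : ℤ}
    (h : 0 < returnTime L T z a) (hT : T ≤ T') : returnTime L T' z a = returnTime L T z a := by
  have h1 := returnTime_le L T z a
  have h2 : returnTime L T' z a ≤ returnTime L T z a :=
    Nat.sInf_le ⟨h, h1.trans hT, block_sub_returnTime h⟩
  have h3 : 0 < returnTime L T' z a := by
    rw [Nat.pos_iff_ne_zero]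
    exact fun h0 =>
      block_ne_of_returnTime_eq_zero h0 h (h1.trans hT) (block_sub_returnTime h).symm
  exact h2.antisymm (Nat.sInf_le ⟨h3, h2.trans h1, block_sub_returnTime h3⟩)

/-- The count stabilizes as the window grows. -/
theorem exists_eventually_returnCount_eq (L : ℕ) (z : ℤ → A × B) (a : ℤ) :
    ∃ n, ∀ᶠ T in atTop, returnCount L T z a = n := by
  by_cases h : ∃ T, 0 < returnTime L T z a
  · obtain ⟨T, hT⟩ := h
    refine ⟨returnCount L T z a, ?_⟩
    filter_upwards [eventually_ge_atTop T] with T' hT'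
    rw [returnCount, returnCount, returnTime_eq_of_le hT hT']
  · push Not at h
    exact ⟨0, Eventually.of_forall fun T => if_neg (not_lt.2 (h T))⟩

theorem cost_le_logb {k n : ℕ} (hn : 0 < n) : (cost k n : ℝ) ≤ Real.logb 2 n := by
  rw [Real.le_logb_iff_rpow_le (by norm_num) (by exact_mod_cast hn), Real.rpow_natCast]
  unfold cost
  split_ifs with h
  · exact_mod_cast Nat.pow_log_le_self 2 hn.ne'
  · have : 2 ^ k ≤ n := by omega
    exact_mod_cast this

variable [Fintype A] [MeasurableSpace A] [MeasurableSingletonClass A]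
  [Fintype B] [MeasurableSpace B] [MeasurableSingletonClass B]

theorem measurable_returnCount (L T : ℕ) (a : ℤ) :
    Measurable fun z : ℤ → A × B => returnCount L T z a :=
  measurable_of_eq_on_Icc (a - T) (a + L) fun _ _ h =>
    returnCount_congr fun j h1 h2 => h j h1 h2.le

theorem measurableSet_returnTime_eq_zero (L T : ℕ) (a : ℤ) :
    MeasurableSet {z : ℤ → A × B | returnTime L T z a = 0} :=
  (measurable_of_eq_on_Icc (f := fun z : ℤ → A × B => returnTime L T z a) (a - T) (a + L)
    fun _ _ h => returnTime_congr fun j h1 h2 => h j h1 h2.le) (measurableSet_singleton 0)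

variable {P : Measure (ℤ → A × B)} [IsProbabilityMeasure P]

theorem integrable_cost_returnCount (k L T : ℕ) (a : ℤ) :
    Integrable (fun z => (cost k (returnCount L T z a) : ℝ)) P := by
  refine Integrable.of_bound (C := k) (Measurable.aestronglyMeasurable ?_)
    (Eventually.of_forall fun z => ?_)
  · exact (measurable_from_nat (f := fun n => (cost k n : ℝ))).comp (measurable_returnCount L T a)
  · simpa using cost_le k _

theorem exists_tendsto_integral_cost (k L : ℕ) :
    ∃ c : ℝ, Tendsto (fun T => ∫ z, (cost k (returnCount L T z 1) : ℝ) ∂P) atTop (𝓝 c) := by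
  choose n hn using fun z : ℤ → A × B => exists_eventually_returnCount_eq L z 1
  refine ⟨∫ z, (cost k (n z) : ℝ) ∂P, tendsto_integral_of_dominated_convergence (fun _ => k)
    (fun T => (integrable_cost_returnCount k L T 1).1) (integrable_const _)
    (fun T => Eventually.of_forall fun z => ?_) (Eventually.of_forall fun z => ?_)⟩
  · simpa using cost_le k _
  · refine tendsto_const_nhds.congr' ?_
    filter_upwards [hn z] with T hT
    rw [hT]

/-- Kac's lemma with side information: the count, averaged over the event that the joint block is
`w`, is at most the probability of the `B`-component of `w`. -/
theorem integral_indicator_returnCount_le (hP : ∀ m, MeasurePreserving (shift m) P P) (L T : ℕ)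
    (w : Fin L → A × B) :
    ∫ z, {z : ℤ → A × B | block L z 1 = w}.indicator (fun z => (returnCount L T z 1 : ℝ)) z ∂P ≤
      P.real {z | block L (fun j => (z j).2) 1 = fun j => (w j).2} := by
  classical
  set Q : (Fin L → A × B) → Prop := fun w' => (fun j => (w' j).2) = fun j => (w j).2 with hQ
  let E : ℕ → Set (ℤ → A × B) := fun t => {z | block L z 1 = w ∧ Q (block L z (1 - t)) ∧
    ∀ s : ℕ, 0 < s → s < t → block L z (1 - s) ≠ w}
  have hE : ∀ t, MeasurableSet (E t) := measurableSet_return L w Q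
  have hint : ∀ t, Integrable ((E t).indicator fun _ => (1 : ℝ)) P := fun t =>
    (integrable_const _).indicator (hE t)
  calc ∫ z, {z : ℤ → A × B | block L z 1 = w}.indicator (fun z => (returnCount L T z 1 : ℝ)) z ∂P
      ≤ ∫ z, ∑ t ∈ Finset.Icc 1 T, (E t).indicator (fun _ => (1 : ℝ)) z ∂P := by
        refine integral_mono_of_nonneg (Eventually.of_forall fun z => ?_)
          (integrable_finsetSum _ fun t _ => hint t) (Eventually.of_forall fun z => ?_)
        · exact Set.indicator_nonneg (fun _ _ => Nat.cast_nonneg _) z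
        · have hsum : ∑ t ∈ Finset.Icc 1 T, (E t).indicator (fun _ => (1 : ℝ)) z =
              ((Finset.Icc 1 T).filter fun t => z ∈ E t).card := by
            rw [Finset.card_filter]
            push_cast
            simp only [Set.indicator_apply]
          simp only
          rw [hsum]
          by_cases hz : z ∈ {z : ℤ → A × B | block L z 1 = w}
          swap
          · rw [Set.indicator_of_notMem hz]
            exact Nat.cast_nonneg _
          rw [Set.indicator_of_mem hz, Nat.cast_le]
          rcases Nat.eq_zero_or_pos (returnTime L T z 1) with h | h
          · rw [returnCount, if_neg (by omega)]
            exact Nat.zero_le _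
          rw [returnCount, if_pos h]
          refine Finset.card_le_card fun t ht => ?_
          rw [Finset.mem_filter, Finset.mem_Icc] at ht ⊢
          refine ⟨⟨ht.1.1, ht.1.2.trans (returnTime_le L T z 1)⟩, hz, ?_, fun s h0 hs => ?_⟩
          · rw [hQ, ← (hz : block L z 1 = w)]
            exact ht.2.symm
          · rw [← (hz : block L z 1 = w)]
            exact block_ne_of_lt_returnTime h0 (hs.trans_le ht.1.2)
    _ = ∑ t ∈ Finset.Icc 1 T, P.real (E t) := by
        rw [integral_finsetSum _ fun t _ => hint t]
        refine Finset.sum_congr rfl fun t _ => ?_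
        rw [integral_indicator_const _ (hE t), smul_eq_mul, mul_one]
    _ ≤ P.real {z | Q (block L z 1)} := sum_measureReal_return_le hP L T w Q

/-- The expected cost of a phrase is at most the conditional entropy of a block, up to a term for
the event that the window contains no match. This is Kac's lemma combined with the tangent
inequality `log n ≤ log c + n / c - 1`, for `c = P(v) / P(u, v)`. -/
theorem integral_cost_le (hP : ∀ m, MeasurePreserving (shift m) P P) (k L T : ℕ) :
    ∫ z, (cost k (returnCount L T z 1) : ℝ) ∂P ≤
      condEntropy P (fun z => block L (fun j => (z j).1) 1) (fun z => block L (fun j => (z j).2) 1) +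
      (k + 1 / Real.log 2) * P.real {z | returnTime L T z 1 = 0} := by
  set F : (ℤ → A × B) → Fin L → A := fun z => block L (fun j => (z j).1) 1
  set G : (ℤ → A × B) → Fin L → B := fun z => block L (fun j => (z j).2) 1
  have hF : ∀ u, MeasurableSet {z | F z = u} := fun u => measurableSet_fst_block L 1 u
  have hG : ∀ v, MeasurableSet {z | G z = v} := fun v => measurableSet_snd_block L 1 v
  set p : (Fin L → A) → (Fin L → B) → ℝ := fun u v => P.real {z | F z = u ∧ G z = v}
  set q : (Fin L → B) → ℝ := fun v => P.real {z | G z = v}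
  have hpq : ∀ u v, p u v ≤ q v := measureReal_fiber_le
  have hp0 : ∀ u v, 0 ≤ p u v := fun u v => measureReal_nonneg
  have hlog : 0 < Real.log 2 := Real.log_pos (by norm_num)
  set n : (ℤ → A × B) → ℝ := fun z => (returnCount L T z 1 : ℝ)
  have hn : Integrable n P := by
    refine Integrable.of_bound (C := T) (Measurable.aestronglyMeasurable ?_)
      (Eventually.of_forall fun z => ?_)
    · exact (measurable_from_nat (f := fun n => (n : ℝ))).comp (measurable_returnCount L T 1)
    · simpa [n] using returnCount_le L T z 1
  have hmeas : ∀ u v, MeasurableSet {z | F z = u ∧ G z = v} := measurableSet_fiber hF hG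
  have hind : ∀ u v, ∫ z, {z | F z = u ∧ G z = v}.indicator n z ∂P ≤ q v := fun u v => by
    have hset : {z : ℤ → A × B | F z = u ∧ G z = v} =
        {z | block L z 1 = fun j => (u j, v j)} := by
      ext z
      simp only [Set.mem_ofPred_eq, F, G, funext_iff, block, Prod.ext_iff, forall_and]
    rw [hset]
    exact integral_indicator_returnCount_le hP L T _
  -- Kac's lemma, weighted with `P(u, v) / P(v)` and summed over `u` and `v`.
  have hsplit : ∀ z, n z * (p (F z) (G z) / q (G z)) =
      ∑ u, ∑ v, p u v / q v * {z | F z = u ∧ G z = v}.indicator n z := fun z => by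
    have h := comp_eq_sum_indicator F G (fun u v => n z * (p u v / q v)) z
    rw [h]
    refine Finset.sum_congr rfl fun u _ => Finset.sum_congr rfl fun v _ => ?_
    by_cases hz : z ∈ {z | F z = u ∧ G z = v}
    · rw [Set.indicator_of_mem hz, Set.indicator_of_mem hz, mul_comm]
    · rw [Set.indicator_of_notMem hz, Set.indicator_of_notMem hz, mul_zero]
  have hni : ∀ u v, Integrable (fun z => p u v / q v * {z | F z = u ∧ G z = v}.indicator n z) P :=
    fun u v => (hn.indicator (hmeas u v)).const_mul _
  have hnpq : Integrable (fun z => n z * (p (F z) (G z) / q (G z))) P := by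
    simp_rw [hsplit]
    exact integrable_finsetSum _ fun u _ => integrable_finsetSum _ fun v _ => hni u v
  have hkac : ∫ z, n z * (p (F z) (G z) / q (G z)) ∂P ≤ 1 := by
    simp_rw [hsplit]
    rw [integral_finsetSum _ fun u _ => integrable_finsetSum _ fun v _ => hni u v]
    calc ∑ u, ∫ z, ∑ v, p u v / q v * {z | F z = u ∧ G z = v}.indicator n z ∂P
        ≤ ∑ u, ∑ v, p u v * 1 := by
          refine Finset.sum_le_sum fun u _ => ?_
          rw [integral_finsetSum _ fun v _ => hni u v]
          refine Finset.sum_le_sum fun v _ => ?_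
          rw [integral_const_mul, mul_one]
          have hq0 : 0 ≤ q v := (hp0 u v).trans (hpq u v)
          calc p u v / q v * _ ≤ p u v / q v * q v :=
                mul_le_mul_of_nonneg_left (hind u v) (div_nonneg (hp0 u v) hq0)
            _ ≤ p u v := by
                rcases hq0.eq_or_lt with h | h
                · rw [← h, mul_zero]
                  exact hp0 u v
                · rw [div_mul_cancel₀ _ h.ne']
      _ = ∫ _z, (1 : ℝ) ∂P := sum_measureReal_mul hF hG fun _ _ => 1
      _ = 1 := by simp
  -- The tangent inequality holds at the points whose joint block has positive probability.
  have hae : ∀ᵐ z ∂P, 0 < p (F z) (G z) := by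
    have h : ∀ u v, ∀ᵐ z ∂P, (F z = u ∧ G z = v) → 0 < p u v := fun u v => by
      rcases (hp0 u v).lt_or_eq with h | h
      · exact Eventually.of_forall fun _ _ => h
      · have h0 : P {z | F z = u ∧ G z = v} = 0 := (measureReal_eq_zero_iff).1 h.symm
        rw [ae_iff]
        refine measure_mono_null (fun z hz => ?_) h0
        by_contra hne
        exact hz fun hz' => absurd hz' hne
    filter_upwards [ae_all_iff.2 fun u => ae_all_iff.2 (h u)] with z hz
    exact hz _ _ ⟨rfl, rfl⟩
  set Z : Set (ℤ → A × B) := {z | returnTime L T z 1 = 0}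
  have hZ : MeasurableSet Z := measurableSet_returnTime_eq_zero L T 1
  have hpoint : ∀ᵐ z ∂P, (cost k (returnCount L T z 1) : ℝ) ≤
      Real.logb 2 (q (G z) / p (F z) (G z)) +
        (n z * (p (F z) (G z) / q (G z)) - 1) / Real.log 2 +
        Z.indicator (fun _ => (k + 1 / Real.log 2 : ℝ)) z := by
    filter_upwards [hae] with z hpz
    have hqz := hpz.trans_le (hpq (F z) (G z))
    by_cases hz : z ∈ Z
    · rw [Set.indicator_of_mem hz]
      have h1 : (cost k (returnCount L T z 1) : ℝ) ≤ k := by exact_mod_cast cost_le k _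
      have h2 : 0 ≤ Real.logb 2 (q (G z) / p (F z) (G z)) :=
        Real.logb_nonneg (by norm_num) ((one_le_div hpz).2 (hpq _ _))
      have h3 : 0 ≤ n z * (p (F z) (G z) / q (G z)) / Real.log 2 := by positivity
      rw [sub_div]
      linarith
    · rw [Set.indicator_of_notMem hz, add_zero]
      have hpos : 0 < returnCount L T z 1 := returnCount_pos (Nat.pos_of_ne_zero hz)
      have hnz : 0 < n z := Nat.cast_pos.2 hpos
      refine (cost_le_logb hpos).trans ?_
      have h1 : Real.log (n z) = Real.log (q (G z) / p (F z) (G z)) +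
          Real.log (n z * (p (F z) (G z) / q (G z))) := by
        rw [← Real.log_mul (by positivity) (by positivity)]
        congr 1
        field_simp
      have h2 := Real.log_le_sub_one_of_pos
        (show 0 < n z * (p (F z) (G z) / q (G z)) by positivity)
      rw [Real.logb, Real.logb, ← add_div]
      exact div_le_div_of_nonneg_right (h1.trans_le (by linarith)) hlog.le
  have hi1 : Integrable (fun z => Real.logb 2 (q (G z) / p (F z) (G z))) P :=
    integrable_comp_fiber hF hG fun u v => Real.logb 2 (q v / p u v)
  have hi2 : Integrable (fun z => (n z * (p (F z) (G z) / q (G z)) - 1) / Real.log 2) P :=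
    (hnpq.sub (integrable_const _)).div_const _
  have hi3 : Integrable (Z.indicator fun _ => (k + 1 / Real.log 2 : ℝ)) P :=
    (integrable_const _).indicator hZ
  refine (integral_mono_ae (integrable_cost_returnCount k L T 1) ((hi1.add hi2).add hi3)
    hpoint).trans ?_
  rw [integral_add' (hi1.add hi2) hi3, integral_add' hi1 hi2, integral_indicator_const _ hZ,
    smul_eq_mul, mul_comm (P.real Z), condEntropy_eq_integral hF hG, integral_div,
    integral_sub hnpq (integrable_const _)]
  have h0 : (∫ z, n z * (p (F z) (G z) / q (G z)) ∂P - ∫ _z, (1 : ℝ) ∂P) / Real.log 2 ≤ 0 :=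
    div_nonpos_of_nonpos_of_nonneg (by simpa using hkac) hlog.le
  have h4 : ∀ a b c : ℝ, b ≤ 0 → a + b + c ≤ a + c := fun a b c h => by linarith
  exact h4 _ _ _ h0

end Count

/-! ### Entropy rate and limits of the expected codelength -/

section Limits

variable {A B : Type*} [Fintype A] [MeasurableSpace A] [MeasurableSingletonClass A]
  [Fintype B] [MeasurableSpace B] [MeasurableSingletonClass B]
  {P : Measure (ℤ → A × B)} [IsProbabilityMeasure P]

/-- The conditional entropy `H(X_1^n | Y_1^n)` of the two coordinate processes under `P`. -/
noncomputable def blockEntropy (P : Measure (ℤ → A × B)) (n : ℕ) : ℝ :=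
  condEntropy P (fun z => block n (fun j => (z j).1) 1) (fun z => block n (fun j => (z j).2) 1)

theorem block_add {S : Type*} (m n : ℕ) (x : ℤ → S) :
    block (m + n) x 1 = Fin.append (block m x 1) (block n x (1 + m)) := by
  funext j
  refine Fin.addCases (fun i => ?_) (fun i => ?_) j
  · rw [Fin.append_left]
    rfl
  · rw [Fin.append_right, block, block]
    congr 1
    simp only [Fin.val_natAdd]
    push_cast
    ring

theorem subadditive_blockEntropy (hP : ∀ m, MeasurePreserving (shift m) P P) :
    Subadditive (blockEntropy P) := by
  intro m n
  have h1 : blockEntropy P (m + n) = condEntropy P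
      (fun z => (block m (fun j => (z j).1) 1, block n (fun j => (z j).1) (1 + m)))
      (fun z => (block m (fun j => (z j).2) 1, block n (fun j => (z j).2) (1 + m))) := by
    rw [← condEntropy_comp_equiv (Fin.appendEquiv m n) (Fin.appendEquiv m n)]
    simp only [blockEntropy, block_add]
    rfl
  have h2 : blockEntropy P n = condEntropy P (fun z => block n (fun j => (z j).1) (1 + m))
      (fun z => block n (fun j => (z j).2) (1 + m)) := by
    rw [blockEntropy]
    nth_rw 1 [← (hP m).map_eq]
    rw [condEntropy_map (measurable_shift _) (measurableSet_fst_block n 1)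
      (measurableSet_snd_block n 1)]
    simp only [← block_shift]
    rfl
  rw [h1, h2]
  exact condEntropy_prod_le (measurableSet_fst_block _ _) (measurableSet_snd_block _ _)
    (measurableSet_fst_block _ _) (measurableSet_snd_block _ _)

theorem exists_tendsto_blockEntropy_div (hP : ∀ m, MeasurePreserving (shift m) P P) :
    ∃ h, Tendsto (fun n : ℕ => blockEntropy P n / n) atTop (𝓝 h) := by
  refine ⟨_, (subadditive_blockEntropy hP).tendsto_lim ⟨0, ?_⟩⟩
  rintro _ ⟨n, rfl⟩
  exact div_nonneg condEntropy_nonneg n.cast_nonneg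

/-- The codelength of `N` phrases of length `L`, as a function on path space. -/
noncomputable def pathLength (N L : ℕ) (z : ℤ → A × B) : ℝ :=
  ((codeword N L (fun j => (z j).1) (fun j => (z j).2)).length : ℝ)

theorem codeLength_eq_pathLength {Ω A B : Type*} [Fintype A] (X : ℤ → Ω → A) (Y : ℤ → Ω → B)
    (N L : ℕ) : codeLength X Y N L = fun ω => pathLength N L fun n => (X n ω, Y n ω) := by
  funext ω
  rw [codeLength, pathLength]

theorem pathLength_eq {A B : Type*} [Fintype A] (N L : ℕ) (z : ℤ → A × B) :
    pathLength N L z = rawBits A L + ∑ m ∈ Finset.range (N - 1),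
      ((Nat.clog 2 (1 + rawBits A L) : ℝ) +
        (cost (rawBits A L) (returnCount L ((m + 1) * L) z (((m + 1) * L : ℕ) + 1)) : ℝ)) := by
  rw [pathLength, length_codeword]
  push_cast
  rfl

theorem measurable_pathLength (N L : ℕ) :
    Measurable (pathLength N L : (ℤ → A × B) → ℝ) :=
  measurable_of_eq_on_Icc 1 (N * L : ℕ) fun z z' h => by
    rw [pathLength, pathLength, length_codeword_congr (fun j h1 h2 => congrArg Prod.fst (h j h1 h2))
      fun j h1 h2 => congrArg Prod.snd (h j h1 h2)]

theorem integrable_pathLength (N L : ℕ) : Integrable (pathLength N L) P := by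
  have h : (pathLength N L : (ℤ → A × B) → ℝ) = _ := funext (pathLength_eq N L)
  rw [h]
  exact (integrable_const _).add (integrable_finsetSum _ fun m _ =>
    (integrable_const _).add (integrable_cost_returnCount _ _ _ _))

theorem integral_cost_add (hP : ∀ m, MeasurePreserving (shift m) P P) (k L T : ℕ) :
    ∫ z, (cost k (returnCount L T z (T + 1)) : ℝ) ∂P =
      ∫ z, (cost k (returnCount L T z 1) : ℝ) ∂P := by
  nth_rw 2 [← (hP T).map_eq]
  rw [integral_map (measurable_shift _).aemeasurable
    (((hP T).map_eq).symm ▸ (integrable_cost_returnCount k L T 1).1)]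
  simp only [returnCount_shift, add_comm]

theorem integral_pathLength (hP : ∀ m, MeasurePreserving (shift m) P P) (N L : ℕ) :
    ∫ z, pathLength N L z ∂P = rawBits A L + ∑ m ∈ Finset.range (N - 1),
      ((Nat.clog 2 (1 + rawBits A L) : ℝ) +
        ∫ z, (cost (rawBits A L) (returnCount L ((m + 1) * L) z 1) : ℝ) ∂P) := by
  have hi : ∀ m : ℕ, Integrable (fun z => (Nat.clog 2 (1 + rawBits A L) : ℝ) +
      (cost (rawBits A L) (returnCount L ((m + 1) * L) z (((m + 1) * L : ℕ) + 1)) : ℝ)) P :=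
    fun m => (integrable_const _).add (integrable_cost_returnCount _ _ _ _)
  simp_rw [pathLength_eq]
  rw [integral_add (integrable_const _) (integrable_finsetSum _ fun m _ => hi m),
    integral_finsetSum _ fun m _ => hi m]
  simp_rw [integral_add (integrable_const _) (integrable_cost_returnCount _ _ _ _),
    integral_cost_add hP]
  simp

/-- The converse: the code is uniquely decodable given the side information, so that its expected
length is at least the conditional entropy. -/
theorem blockEntropy_le_integral_pathLength {N : ℕ} (hN : 1 ≤ N) (L : ℕ) :
    blockEntropy P (N * L) ≤ ∫ z, pathLength N L z ∂P := by
  obtain ⟨z₀⟩ : Nonempty (ℤ → A × B) := nonempty_of_isProbabilityMeasure P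
  have : Nonempty A := ⟨(z₀ 0).1⟩
  have : Nonempty B := ⟨(z₀ 0).2⟩
  let len : (Fin (N * L) → A) → (Fin (N * L) → B) → ℕ := fun u v =>
    (codeword N L (extend u) (extend v)).length
  have h := condEntropy_le_sum (μ := P) (measurableSet_fst_block (N * L) 1)
    (measurableSet_snd_block (N * L) 1) (fun u v => (1 / 2 : ℝ) ^ len u v)
    (fun u v => (len u v : ℝ)) (fun _ _ => by positivity)
    (fun v => kraft_codeword hN L (extend v) _ rfl) fun u v _ => ⟨by positivity, le_of_eq ?_⟩
  · refine h.trans_eq ?_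
    rw [sum_measureReal_mul (measurableSet_fst_block (N * L) 1)
      (measurableSet_snd_block (N * L) 1)]
    refine integral_congr_ae (Eventually.of_forall fun z => ?_)
    simp only [len, pathLength]
    rw [length_codeword_congr (fun j h1 h2 => extend_block _ h1 h2)
      fun j h1 h2 => extend_block _ h1 h2]
  · rw [Real.logb_pow, one_div, Real.logb_inv, Real.logb_self_eq_one (by norm_num)]
    ring

theorem tendsto_clog_rawBits_div (A : Type*) [Fintype A] :
    Tendsto (fun L : ℕ => (Nat.clog 2 (1 + rawBits A L) : ℝ) / L) atTop (𝓝 0) := by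
  set a : ℝ := max 0 (Real.logb 2 (Fintype.card A))
  have ha : 0 ≤ a := le_max_left _ _
  have hlog : 0 < Real.log 2 := Real.log_pos (by norm_num)
  -- `⌈log₂ (1 + k)⌉ ≤ log₂ (1 + k) + 1` and `k ≤ L a + 1` give the bound `log₂ (2 (a + 2) L)`.
  have hbound : ∀ L : ℕ, 1 ≤ L → (Nat.clog 2 (1 + rawBits A L) : ℝ) ≤
      (Real.log (2 * (a + 2)) + Real.log L) / Real.log 2 := by
    intro L hL
    have hL' : (1 : ℝ) ≤ L := by exact_mod_cast hL
    have hk : (rawBits A L : ℝ) ≤ L * a + 1 := by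
      have h1 : rawBits A L ≤ ⌈(L : ℝ) * a⌉₊ :=
        Nat.ceil_mono (mul_le_mul_of_nonneg_left (le_max_right _ _) L.cast_nonneg)
      exact (Nat.cast_le.2 h1).trans (Nat.ceil_lt_add_one (by positivity)).le
    have h2 : (Nat.clog 2 (1 + rawBits A L) : ℝ) ≤
        Real.logb 2 ((1 + rawBits A L : ℕ) : ℝ) + 1 := by
      have h3 := Real.natCeil_logb_natCast 2 (1 + rawBits A L)
      rw [← h3]
      refine (Nat.ceil_lt_add_one (Real.logb_nonneg (by norm_num) ?_)).le
      exact_mod_cast Nat.le_add_right 1 _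
    refine h2.trans ?_
    rw [← Real.log_mul (by positivity) (by positivity), Real.logb, div_add_one hlog.ne',
      ← Real.log_mul (by positivity) (by norm_num)]
    refine div_le_div_of_nonneg_right (Real.log_le_log (by positivity) ?_) hlog.le
    push_cast
    nlinarith
  have hlim : Tendsto (fun L : ℕ => (Real.log (2 * (a + 2)) / L + Real.log L / L) / Real.log 2)
      atTop (𝓝 0) := by
    have h1 : Tendsto (fun L : ℕ => Real.log L / L) atTop (𝓝 0) :=
      Real.isLittleO_log_id_atTop.tendsto_div_nhds_zero.comp tendsto_natCast_atTop_atTop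
    simpa using ((tendsto_const_div_atTop_nhds_zero_nat (Real.log (2 * (a + 2)))).add h1).div_const
      (Real.log 2)
  refine squeeze_zero' (Eventually.of_forall fun L => by positivity) ?_ hlim
  filter_upwards [eventually_ge_atTop 1] with L hL
  refine (div_le_div_of_nonneg_right (hbound L hL) L.cast_nonneg).trans_eq ?_
  ring

/-- The two limits of the expected codelength exist, and the iterated limit is the entropy rate: the
upper bound for `R L` comes from Kac's lemma, the lower bound from Kraft's inequality. -/
theorem exists_tendsto_integral_pathLength_div (hP : ∀ m, MeasurePreserving (shift m) P P) {h : ℝ}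
    (hh : Tendsto (fun n : ℕ => blockEntropy P n / n) atTop (𝓝 h)) :
    ∃ R : ℕ → ℝ, (∀ L : ℕ, 1 ≤ L →
      Tendsto (fun N : ℕ => (∫ z, pathLength N L z ∂P) / ((N : ℝ) * L)) atTop (𝓝 (R L))) ∧
      Tendsto R atTop (𝓝 h) := by
  choose c hc using fun L => exists_tendsto_integral_cost (P := P) (rawBits A L) L
  have hR : ∀ L : ℕ, 1 ≤ L →
      Tendsto (fun N : ℕ => (∫ z, pathLength N L z ∂P) / ((N : ℝ) * L)) atTop
        (𝓝 ((Nat.clog 2 (1 + rawBits A L) + c L) / L)) := by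
    intro L hL
    set k := rawBits A L
    -- `v i` is the expected codelength of the phrase with index `i + 1`.
    let v : ℕ → ℝ := fun i => i.casesOn (k : ℝ) fun m =>
      (Nat.clog 2 (1 + k) : ℝ) + ∫ z, (cost k (returnCount L ((m + 1) * L) z 1) : ℝ) ∂P
    have hmL : Tendsto (fun m : ℕ => (m + 1) * L) atTop atTop :=
      (tendsto_add_atTop_nat 1).atTop_mul_const' (by omega)
    have hv : Tendsto v atTop (𝓝 (Nat.clog 2 (1 + k) + c L)) :=
      (tendsto_add_atTop_iff_nat 1).1 (((hc L).comp hmL).const_add _)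
    refine (hv.cesaro.div_const (L : ℝ)).congr' ?_
    filter_upwards [eventually_ge_atTop 1] with N hN
    obtain ⟨M, rfl⟩ : ∃ M, N = M + 1 := ⟨N - 1, by omega⟩
    rw [integral_pathLength hP, Finset.sum_range_succ', Nat.add_sub_cancel, add_comm (k : ℝ),
      ← div_div, inv_mul_eq_div]
    rfl
  refine ⟨_, hR, ?_⟩
  refine tendsto_of_tendsto_of_tendsto_of_le_of_le' tendsto_const_nhds
    (h := fun L : ℕ => (Nat.clog 2 (1 + rawBits A L) : ℝ) / L + blockEntropy P L / L)
    (by simpa using (tendsto_clog_rawBits_div A).add hh) ?_ ?_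
  · filter_upwards [eventually_ge_atTop 1] with L hL
    have hNL : Tendsto (fun N : ℕ => N * L) atTop atTop :=
      tendsto_id.atTop_mul_const' (by omega)
    refine le_of_tendsto_of_tendsto (hh.comp hNL) (hR L hL) ?_
    filter_upwards [eventually_ge_atTop 1] with N hN
    simp only [Function.comp_apply, Nat.cast_mul]
    exact div_le_div_of_nonneg_right (blockEntropy_le_integral_pathLength hN L) (by positivity)
  · refine Eventually.of_forall fun L => ?_
    rw [← add_div]
    refine div_le_div_of_nonneg_right (add_le_add_right ?_ _) L.cast_nonneg
    refine le_of_tendsto_of_tendsto' (hc L)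
      (by simpa [blockEntropy] using ((tendsto_measureReal_returnTime_eq_zero hP L).const_mul
        (rawBits A L + 1 / Real.log 2)).const_add (blockEntropy P L))
      fun T => integral_cost_le hP _ L T

end Limits

end SideInfoLZ

theorem theorem2 {Ω A B : Type*} [MeasurableSpace Ω]
    [Fintype A] [MeasurableSpace A] [MeasurableSingletonClass A]
    [Fintype B] [MeasurableSpace B] [MeasurableSingletonClass B]
    (μ : Measure Ω) [IsProbabilityMeasure μ]
    (X : ℤ → Ω → A) (Y : ℤ → Ω → B)
    (hX : ∀ n, Measurable (X n)) (hY : ∀ n, Measurable (Y n))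
    (hXY : SideInfoLZ.JointlyStationary μ X Y) :
    -- the conditional entropy rate exists as a limit
    Tendsto (SideInfoLZ.condEntropyPerSymbol μ X Y) atTop
      (𝓝 (SideInfoLZ.condEntropyRate μ X Y)) ∧
    -- the expected codelengths are finite
    (∀ N L : ℕ, Integrable (SideInfoLZ.codeLength X Y N L) μ) ∧
    -- both limits exist, and the iterated limit is at most the conditional entropy rate
    ∃ (R : ℕ → ℝ) (r : ℝ),
      (∀ L : ℕ, 1 ≤ L →
        Tendsto (fun N : ℕ => (∫ ω, SideInfoLZ.codeLength X Y N L ω ∂μ) / ((N : ℝ) * L)) atTop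
          (𝓝 (R L))) ∧
      Tendsto R atTop (𝓝 r) ∧
      r ≤ SideInfoLZ.condEntropyRate μ X Y := by
  have hZ : Measurable fun ω (n : ℤ) => (X n ω, Y n ω) :=
    measurable_pi_lambda _ fun n => (hX n).prodMk (hY n)
  set P : Measure (ℤ → A × B) := μ.map fun ω n => (X n ω, Y n ω) with hPdef
  have : IsProbabilityMeasure P := Measure.isProbabilityMeasure_map hZ.aemeasurable
  have hP : ∀ m, MeasurePreserving (SideInfoLZ.shift m) P P := fun m =>
    ⟨SideInfoLZ.measurable_shift m, by
      rw [hPdef, Measure.map_map (SideInfoLZ.measurable_shift m) hZ]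
      exact hXY m⟩
  have hent : SideInfoLZ.condEntropyPerSymbol μ X Y = fun n => SideInfoLZ.blockEntropy P n / n := by
    funext n
    rw [SideInfoLZ.blockEntropy, hPdef, SideInfoLZ.condEntropy_map hZ
      (SideInfoLZ.measurableSet_fst_block n 1) (SideInfoLZ.measurableSet_snd_block n 1)]
    rfl
  obtain ⟨h, hh⟩ := SideInfoLZ.exists_tendsto_blockEntropy_div hP
  have hrate : SideInfoLZ.condEntropyRate μ X Y = h := by
    rw [SideInfoLZ.condEntropyRate, hent]
    exact hh.limUnder_eq
  obtain ⟨R, hR, hlim⟩ := SideInfoLZ.exists_tendsto_integral_pathLength_div hP hh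
  refine ⟨by rw [hrate, hent]; exact hh, fun N L => ?_, R, h, fun L hL => ?_, hlim, hrate.ge⟩
  · rw [SideInfoLZ.codeLength_eq_pathLength]
    exact (SideInfoLZ.integrable_pathLength N L).comp_measurable hZ
  · refine (hR L hL).congr fun N => ?_
    rw [SideInfoLZ.codeLength_eq_pathLength, hPdef, integral_map hZ.aemeasurable
      (SideInfoLZ.measurable_pathLength N L).aestronglyMeasurable]
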